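/- Let $n,d\ge 3$, let $S=\mathbb{C}[x_0,\dots,x_n]$ with its standard grading, and let $f\in S$ be a nonzero homogeneous polynomial of degree $d$, defining the hypersurface $V(f):f=0$ in $\mathbb{P}^n$ with singular set $V_s$ (the points of $V(f)$ where all first order partial derivatives of $f$ vanish). Let $J(f)\subset S$ be the ideal generated by the partial derivatives of $f$, let $I(f)$ be the saturation of $J(f)$ with respect to the maximal ideal $(x_0,\dots,x_n)$, and let $N(f)=I(f)/J(f)$ be the Jacobian module, a graded $S$-module with homogeneous components $N(f)_k$. Let $\ell\in S$ be a nonzero linear form and $H:\ell=0$ the corresponding hyperplane. Assume that $H\cap V_s=\emptyset$ and that the hyperplane section $V(f,\ell)=V(f)\cap H$ is singular. Choose linear coordinates $y_1,\dots,y_n$ on $H\cong\mathbb{P}^{n-1}$, and let $g\in R=\mathbb{C}[y_1,\dots,y_n]$ be the restriction of $f$ to $H$, so that $V(f,\ell)$ is the hypersurface $g=0$ in $H$; "singular" means that all the partial derivatives $g_j=\partial g/\partial y_j$ vanish at some point of this hypersurface. Let $I(g)\subset R$ be the saturation of $J(g)=(g_1,\dots,g_n)$ with respect to $(y_1,\dots,y_n)$,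 and let $\mathrm{Syz}(g)=\{(a_1,\dots,a_n)\in R^n : a_1g_1+\dots+a_ng_n=0\}$, whose component $\mathrm{Syz}(g)_j$ consists of the syzygies with all $a_i$ homogeneous of degree $j$. Put $$s(g)=\min\{j\in\mathbb{N} : I(g)_j\neq 0\},\qquad r(g)=\min\{j\in\mathbb{N} : \mathrm{Syz}(g)_j\neq 0\},$$ $$k_0=\min\{d-3+r(g),\; d-3+s(g)\}.$$ Then the multiplication map $\ell: N(f)_k\to N(f)_{k+1}$ is injective for every integer $k$ with $0\le k\le k_0$, and it is surjective for every integer $k\ge (n+1)(d-2)-k_0$. -/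

import Mathlib

open MvPolynomial
open scoped LinearAlgebra.Projectivization

noncomputable section

namespace JacobianModule

variable {m : ℕ}

/-- The Jacobian ideal `J(f)`, generated by the first order partial derivatives of `f`. -/
def jacobianIdeal (f : MvPolynomial (Fin m) ℂ) : Ideal (MvPolynomial (Fin m) ℂ) :=
  Ideal.span (Set.range fun i => pderiv i f)

/-- The maximal homogeneous ideal, generated by all the variables. -/
def irrelevantIdeal (m : ℕ) : Ideal (MvPolynomial (Fin m) ℂ) :=
  Ideal.span (Set.range X)

/-- The saturation `⋃ N, (J : 𝔪 ^ N)` of an ideal `J` with respect to the ideal `𝔪` generated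
by all the variables. -/
def saturation (J : Ideal (MvPolynomial (Fin m) ℂ)) : Ideal (MvPolynomial (Fin m) ℂ) :=
  ⨆ N : ℕ, J.colon ((irrelevantIdeal m ^ N : Ideal (MvPolynomial (Fin m) ℂ)) :
    Set (MvPolynomial (Fin m) ℂ))

/-- The saturation `I(f)` of the Jacobian ideal. -/
def saturatedJacobianIdeal (f : MvPolynomial (Fin m) ℂ) : Ideal (MvPolynomial (Fin m) ℂ) :=
  saturation (jacobianIdeal f)

/-- The union defining the saturation is increasing, so that membership is as expected. -/
theorem mem_saturation_iff (J : Ideal (MvPolynomial (Fin m) ℂ)) (q : MvPolynomial (Fin m) ℂ) :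
    q ∈ saturation J ↔ ∃ N : ℕ, ∀ p ∈ irrelevantIdeal m ^ N, q * p ∈ J := by
  unfold saturation
  rw [Submodule.mem_iSup_of_directed]
  · simp [Submodule.mem_colon]
  · refine directed_of_isDirected_le ?_
    intro a b hab q hq
    rw [Submodule.mem_colon] at hq ⊢
    exact fun p hp => hq p (Ideal.pow_le_pow_right hab hp)

/-- The Jacobian module `N(f) = I(f) / J(f)`, a module over the polynomial ring. -/
abbrev N (f : MvPolynomial (Fin m) ℂ) : Type :=
  saturatedJacobianIdeal f ⧸ (jacobianIdeal f).submoduleOf (saturatedJacobianIdeal f)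

/-- The graded piece `N(f)_k`: the classes of the homogeneous elements of degree `k` of `I(f)`. -/
def piece (f : MvPolynomial (Fin m) ℂ) (k : ℕ) : Submodule ℂ (N f) :=
  ((homogeneousSubmodule (Fin m) ℂ k).comap
    ((saturatedJacobianIdeal f).subtype.restrictScalars ℂ)).map
    (((jacobianIdeal f).submoduleOf (saturatedJacobianIdeal f)).mkQ.restrictScalars ℂ)

/-- The linear form `∑ i, ℓ(e_i) x_i` attached to a linear functional `ℓ`. -/
def linearForm (ℓ : Module.Dual ℂ (Fin m → ℂ)) : MvPolynomial (Fin m) ℂ :=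
  ∑ i, C (ℓ (Pi.single i 1)) * X i

theorem linearForm_isHomogeneous (ℓ : Module.Dual ℂ (Fin m → ℂ)) :
    (linearForm ℓ).IsHomogeneous 1 := by
  refine IsHomogeneous.sum _ _ _ fun i _ => ?_
  simpa using (isHomogeneous_C (Fin m) (ℓ (Pi.single i 1))).mul (isHomogeneous_X ℂ i)

theorem eval_linearForm (ℓ : Module.Dual ℂ (Fin m → ℂ)) (v : Fin m → ℂ) :
    eval v (linearForm ℓ) = ℓ v := by
  conv_rhs => rw [LinearMap.pi_apply_eq_sum_univ ℓ v]
  simp only [linearForm, map_sum, map_mul, eval_C, eval_X, smul_eq_mul]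
  refine Finset.sum_congr rfl fun i _ => ?_
  rw [mul_comm]
  congr 2
  ext j
  simp [Pi.single_apply, eq_comm]

theorem smul_mem_piece (f : MvPolynomial (Fin m) ℂ) (ℓ : Module.Dual ℂ (Fin m → ℂ)) (k : ℕ)
    (z : N f) (hz : z ∈ piece f k) :
    Algebra.lsmul ℂ ℂ (N f) (linearForm ℓ) z ∈ piece f (k + 1) := by
  obtain ⟨q, hq, rfl⟩ := hz
  refine ⟨linearForm ℓ • q, ?_, rfl⟩
  have h := (linearForm_isHomogeneous ℓ).mul (show (q : MvPolynomial (Fin m) ℂ).IsHomogeneous k from hq)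
  rw [add_comm] at h
  exact h

/-- The multiplication map `ℓ : N(f)_k → N(f)_{k+1}`. -/
def mulMap (f : MvPolynomial (Fin m) ℂ) (ℓ : Module.Dual ℂ (Fin m → ℂ)) (k : ℕ) :
    piece f k →ₗ[ℂ] piece f (k + 1) :=
  (Algebra.lsmul ℂ ℂ (N f) (linearForm ℓ)).restrict (smul_mem_piece f ℓ k)

/-- The singular points of the projective hypersurface `f = 0`, for `f` homogeneous: the points
of the hypersurface at which all the partial derivatives of `f` vanish. As `f` and its partial
derivatives are homogeneous, the choice of homogeneous coordinates of `p` does not matter. -/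
def singularLocus (f : MvPolynomial (Fin m) ℂ) : Set (ℙ ℂ (Fin m → ℂ)) :=
  {p | eval p.rep f = 0 ∧ ∀ i, eval p.rep (pderiv i f) = 0}

/-- The projective hyperplane `ℓ = 0`. -/
def hyperplane (ℓ : Module.Dual ℂ (Fin m → ℂ)) : Set (ℙ ℂ (Fin m → ℂ)) :=
  {p | ℓ p.rep = 0}

/-- The equation of the section of `f = 0` by the hyperplane `ℓ = 0`, in the linear
coordinates `y` on this hyperplane given by a basis `b` of the kernel of `ℓ`:
`g(y) = f(∑ j, y_j b_j)`. -/
def hyperplaneSection {n : ℕ} (f : MvPolynomial (Fin m) ℂ) (ℓ : Module.Dual ℂ (Fin m → ℂ))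
    (b : Module.Basis (Fin n) ℂ (LinearMap.ker ℓ)) : MvPolynomial (Fin n) ℂ :=
  aeval (fun i => ∑ j, C ((b j : Fin m → ℂ) i) * X j) f

/-- The module `Syz(g)` of first order syzygies of the partial derivatives of `g`. -/
def syz (g : MvPolynomial (Fin m) ℂ) :
    Submodule (MvPolynomial (Fin m) ℂ) (Fin m → MvPolynomial (Fin m) ℂ) :=
  LinearMap.ker (Fintype.linearCombination (MvPolynomial (Fin m) ℂ) fun i => pderiv i g)

theorem mem_syz_iff (g : MvPolynomial (Fin m) ℂ) (a : Fin m → MvPolynomial (Fin m) ℂ) :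
    a ∈ syz g ↔ ∑ i, a i * pderiv i g = 0 := by
  simp [syz, Fintype.linearCombination_apply]

/-- The initial degree `s(g)` of the graded ideal `I(g)`. -/
def s (g : MvPolynomial (Fin m) ℂ) : ℕ :=
  sInf {j | ∃ p ∈ saturatedJacobianIdeal g, p.IsHomogeneous j ∧ p ≠ 0}

/-- The initial degree `r(g)` of the graded module `Syz(g)`, where a syzygy has degree `j` if all
its components are homogeneous of degree `j`. -/
def r (g : MvPolynomial (Fin m) ℂ) : ℕ :=
  sInf {j | ∃ a ∈ syz g, (∀ i, (a i).IsHomogeneous j) ∧ a ≠ 0}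

end JacobianModule

end

/-!
Write `J` for the Jacobian ideal of `f`, and let `w` be a direction transverse to `ℓ = 0`. As the
hyperplane misses the singular locus, the restriction of `J` to it, generated by `J(g)` and by the
restriction of `∂f/∂w`, contains a power of the irrelevant ideal.

*Injectivity.* A relation `ℓ p ∈ J` restricts to a relation between the partial derivatives of `g`
and the restriction of `∂f/∂w`. The coefficient of the latter lies in `I(g)` and vanishes below the
degree `s(g)`; the others then form a syzygy, and vanish below the degree `r(g)`. Hence all the
coefficients are divisible by `ℓ`, and `p ∈ J`, whether or not `p ∈ I(f)`.

*Surjectivity.* The ideal `J` has generators `q₁, …, qₙ, p` such that `ℓ, q₁, …, qₙ` is a regular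
sequence, because `n` general combinations of the partial derivatives have no common zero on the
hyperplane. The quotient by `q₁, …, qₙ` of the polynomials on the hyperplane is Gorenstein, so that
membership of `c ∈ I(f)` in `J + (ℓ)` may be tested on the `u` of complementary degree with
`p u ∈ (q₁, …, qₙ, ℓ)`. As `ℓ` is injective on `S/J` in the degree concerned, such a `u` may be
changed modulo `ℓ` so that `p u ∈ (q₁, …, qₙ)`. Then `u J ⊆ (q₁, …, qₙ)`, and `c u` lies there too,
`ℓ` being regular modulo this ideal.
-/

namespace JacobianModule

attribute [local instance] MvPolynomial.gradedAlgebra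

section Ideals

variable {R : Type*} [CommRing R] {U V : Ideal R}

theorem mem_sup_span_singleton_iff {p x : R} :
    x ∈ V ⊔ Ideal.span {p} ↔ ∃ c, x - c * p ∈ V := by
  rw [sup_comm, Ideal.mem_span_singleton_sup]
  constructor
  · rintro ⟨c, v, hv, rfl⟩
    exact ⟨c, by rwa [add_sub_cancel_left]⟩
  · rintro ⟨c, hc⟩
    exact ⟨c, _, hc, add_sub_cancel _ _⟩

theorem isSMulRegular_quotient_iff {a : R} :
    IsSMulRegular (R ⧸ V) a ↔ ∀ x, a * x ∈ V → x ∈ V :=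
  isSMulRegular_quotient_iff_mem_of_smul_mem V a

theorem mem_of_mul_mem {a x : R} (ha : IsSMulRegular (R ⧸ V) a) (h : a * x ∈ V) : x ∈ V :=
  isSMulRegular_quotient_iff.1 ha x h

theorem isSMulRegular_quotient_of_sub_mem {a b : R} (h : a - b ∈ V)
    (ha : IsSMulRegular (R ⧸ V) a) : IsSMulRegular (R ⧸ V) b := by
  refine isSMulRegular_quotient_iff.2 fun x hx => mem_of_mul_mem ha ?_
  convert V.add_mem hx (V.mul_mem_right x h) using 1
  ring

theorem isSMulRegular_quotient_swap {w p : R} (hw : IsSMulRegular (R ⧸ V) w)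
    (hp : IsSMulRegular (R ⧸ V ⊔ Ideal.span {w}) p) :
    IsSMulRegular (R ⧸ V ⊔ Ideal.span {p}) w := by
  refine isSMulRegular_quotient_iff.2 fun x hx => ?_
  obtain ⟨y, hy⟩ := mem_sup_span_singleton_iff.1 hx
  have hpy : p * y ∈ V ⊔ Ideal.span {w} :=
    mem_sup_span_singleton_iff.2 ⟨x, by convert V.neg_mem hy using 1; ring⟩
  obtain ⟨c, hc⟩ := mem_sup_span_singleton_iff.1 (mem_of_mul_mem hp hpy)
  refine mem_sup_span_singleton_iff.2 ⟨c, mem_of_mul_mem hw ?_⟩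
  convert V.add_mem hy (V.mul_mem_left p hc) using 1
  ring

theorem sup_span_singleton_eq_of_sub_mem {a b : R} (h : a - b ∈ V) :
    V ⊔ Ideal.span {a} = V ⊔ Ideal.span {b} := by
  have hle : ∀ a b : R, a - b ∈ V → V ⊔ Ideal.span {a} ≤ V ⊔ Ideal.span {b} := fun a b h =>
    sup_le le_sup_left ((Ideal.span_singleton_le_iff_mem _).2
      (mem_sup_span_singleton_iff.2 ⟨1, by rwa [one_mul]⟩))
  exact (hle a b h).antisymm (hle b a (by rw [← neg_sub]; exact V.neg_mem h))

/-- The element `s` generates the socle of `R ⧸ I`, and this socle is simple and essential: every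
ideal strictly containing `I` contains `s`, which is not in `I`. -/
def IsSocleGenerator (I : Ideal R) (s : R) : Prop :=
  s ∉ I ∧ ∀ x, x ∉ I → s ∈ I ⊔ Ideal.span {x}

theorem IsSocleGenerator.pow_mul_mem_of_mul_mem {t s y : R}
    (hs : IsSocleGenerator (U ⊔ Ideal.span {t}) s) (ht : IsSMulRegular (R ⧸ U) t) {k : ℕ}
    (hy : y ∉ U ⊔ Ideal.span {t ^ (k + 1)}) (hty : t * y ∈ U ⊔ Ideal.span {t ^ (k + 1)}) :
    t ^ k * s ∈ U ⊔ Ideal.span {t ^ (k + 1)} ⊔ Ideal.span {y} := by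
  obtain ⟨c, hc⟩ := mem_sup_span_singleton_iff.1 hty
  have hyc : y - c * t ^ k ∈ U := mem_of_mul_mem ht (by convert hc using 1; ring)
  have hct : c ∉ U ⊔ Ideal.span {t} := by
    intro h
    obtain ⟨z, hz⟩ := mem_sup_span_singleton_iff.1 h
    refine hy (mem_sup_span_singleton_iff.2 ⟨z, ?_⟩)
    convert U.add_mem hyc (U.mul_mem_left (t ^ k) hz) using 1
    ring
  obtain ⟨v, hv⟩ := mem_sup_span_singleton_iff.1 (hs.2 c hct)
  obtain ⟨z, hz⟩ := mem_sup_span_singleton_iff.1 hv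
  refine mem_sup_span_singleton_iff.2 ⟨v, mem_sup_span_singleton_iff.2 ⟨z, ?_⟩⟩
  convert U.sub_mem (U.mul_mem_left (t ^ k) hz) (U.mul_mem_left v hyc) using 1
  ring

theorem IsSocleGenerator.pow_mul {t s : R} (hs : IsSocleGenerator (U ⊔ Ideal.span {t}) s)
    (ht : IsSMulRegular (R ⧸ U) t) (k : ℕ) :
    IsSocleGenerator (U ⊔ Ideal.span {t ^ (k + 1)}) (t ^ k * s) := by
  set I := U ⊔ Ideal.span {t ^ (k + 1)}
  refine ⟨fun h => hs.1 ?_, fun x hx => ?_⟩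
  · obtain ⟨c, hc⟩ := mem_sup_span_singleton_iff.1 h
    refine mem_sup_span_singleton_iff.2 ⟨c, mem_of_mul_mem (ht.pow k) ?_⟩
    convert hc using 1
    ring
  · have hmem : ∀ j x, x ∉ I → t ^ j * x ∈ I → t ^ k * s ∈ I ⊔ Ideal.span {x} := by
      intro j
      induction j with
      | zero => exact fun x hx h => absurd (by simpa using h) hx
      | succ j ih =>
        intro x hx h
        by_cases htx : t * x ∈ I
        · exact hs.pow_mul_mem_of_mul_mem ht hx htx
        · have hle : Ideal.span {t * x} ≤ Ideal.span {x} :=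
            Ideal.span_singleton_le_span_singleton.2 (Dvd.intro_left t rfl)
          exact sup_le_sup_left hle I (ih _ htx (by rwa [← mul_assoc, ← pow_succ]))
    exact hmem (k + 1) x hx
      (I.mul_mem_right _ (Ideal.mem_sup_right (Ideal.mem_span_singleton_self _)))

theorem IsSocleGenerator.of_mul {a p s y : R} (ha : IsSMulRegular (R ⧸ U) a)
    (hs : IsSocleGenerator (U ⊔ Ideal.span {a * p}) s)
    (hy : s - y * a ∈ U ⊔ Ideal.span {a * p}) : IsSocleGenerator (U ⊔ Ideal.span {p}) y := by
  obtain ⟨e, he⟩ := mem_sup_span_singleton_iff.1 hy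
  refine ⟨fun h => hs.1 ?_, fun x hx => ?_⟩
  · obtain ⟨c, hc⟩ := mem_sup_span_singleton_iff.1 h
    refine mem_sup_span_singleton_iff.2 ⟨c + e, ?_⟩
    convert U.add_mem he (U.mul_mem_left a hc) using 1
    ring
  · have hax : a * x ∉ U ⊔ Ideal.span {a * p} := by
      intro h
      obtain ⟨c, hc⟩ := mem_sup_span_singleton_iff.1 h
      exact hx (mem_sup_span_singleton_iff.2 ⟨c, mem_of_mul_mem ha (by convert hc using 1; ring)⟩)
    obtain ⟨z, hz⟩ := mem_sup_span_singleton_iff.1 (hs.2 _ hax)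
    obtain ⟨c, hc⟩ := mem_sup_span_singleton_iff.1 hz
    refine mem_sup_span_singleton_iff.2
      ⟨z, mem_sup_span_singleton_iff.2 ⟨c - e, mem_of_mul_mem ha ?_⟩⟩
    convert U.sub_mem hc he using 1
    ring

theorem mul_mem_sup_of_link {Q : Ideal R} {l p u w c : R} (hl : IsSMulRegular (R ⧸ Q) l)
    (hpu : p * u - w * l ∈ Q) (hw : w ∈ Q ⊔ Ideal.span {p}) {M : ℕ}
    (hc : l ^ M * c ∈ Q ⊔ Ideal.span {p}) : c * u ∈ Q ⊔ Ideal.span {l} := by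
  obtain ⟨y, hy⟩ := mem_sup_span_singleton_iff.1 hw
  obtain ⟨z, hz⟩ := mem_sup_span_singleton_iff.1 hc
  have hp : p * (u - y * l) ∈ Q := by
    convert Q.add_mem hpu (Q.mul_mem_left l hy) using 1
    ring
  refine mem_sup_span_singleton_iff.2 ⟨c * y, mem_of_mul_mem (hl.pow M) ?_⟩
  convert Q.add_mem (Q.mul_mem_left (u - y * l) hz) (Q.mul_mem_left z hp) using 1
  ring

theorem span_range_eq_sup {ι : Type*} (q : ι → R) (i : ι) :
    Ideal.span (Set.range q) = Ideal.span (q '' {i}ᶜ) ⊔ Ideal.span {q i} := by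
  rw [← Ideal.span_union, ← Set.image_singleton, ← Set.image_union, Set.compl_union_self,
    Set.image_univ]

theorem span_image_insert {ι : Type*} (q : ι → R) (T : Set ι) (i : ι) :
    Ideal.span (q '' insert i T) = Ideal.span (q '' T) ⊔ Ideal.span {q i} := by
  rw [Set.image_insert_eq, Ideal.span_insert, sup_comm]

theorem map_span_range {S ι : Type*} [CommRing S] {F : Type*} [FunLike F R S] [RingHomClass F R S]
    (φ : F) (q : ι → R) :
    (Ideal.span (Set.range q)).map φ = Ideal.span (Set.range fun i => φ (q i)) := by
  rw [Ideal.map_span, ← Set.range_comp]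
  rfl

theorem span_range_sub_sup {n : ℕ} (F : Fin (n + 1) → R) (i₀ : Fin (n + 1)) (c : Fin n → R) :
    Ideal.span (Set.range fun j => F (i₀.succAbove j) - c j * F i₀) ⊔ Ideal.span {F i₀} =
      Ideal.span (Set.range F) := by
  have hF : ∀ i, F i ∈ Ideal.span (Set.range F) := fun i => Ideal.subset_span ⟨i, rfl⟩
  apply le_antisymm
  · refine sup_le (Ideal.span_le.2 ?_) ((Ideal.span_singleton_le_iff_mem _).2 (hF i₀))
    rintro _ ⟨j, rfl⟩
    exact sub_mem (hF _) (Ideal.mul_mem_left _ _ (hF i₀))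
  · refine Ideal.span_le.2 ?_
    rintro _ ⟨i, rfl⟩
    induction i using Fin.succAboveCases i₀ with
    | x => exact Ideal.mem_sup_right (Ideal.mem_span_singleton_self _)
    | p j => exact mem_sup_span_singleton_iff.2 ⟨c j, Ideal.subset_span ⟨j, rfl⟩⟩

end Ideals

section Graded

variable {σ R : Type*}

section CommSemiring

variable [CommSemiring R] {p : MvPolynomial σ R} {e : ℕ}

theorem homogeneousComponent_add_mul (hp : p.IsHomogeneous e) (a : MvPolynomial σ R) (k : ℕ) :
    homogeneousComponent (k + e) (a * p) = homogeneousComponent k a * p := by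
  rw [← decomposition.decompose'_apply, ← decomposition.decompose'_apply]
  exact DirectSum.coe_decompose_mul_add_of_right_mem (homogeneousSubmodule σ R) hp

theorem homogeneousComponent_mul_of_lt (hp : p.IsHomogeneous e) (a : MvPolynomial σ R) {k : ℕ}
    (hk : k < e) : homogeneousComponent k (a * p) = 0 := by
  rw [← decomposition.decompose'_apply]
  exact DirectSum.coe_decompose_mul_of_right_mem_of_not_le (homogeneousSubmodule σ R) hp hk.not_ge

theorem eq_zero_of_mem_span_of_lt {ι : Type*} {q : ι → MvPolynomial σ R} {k : ℕ}
    (hq : ∀ i, (q i).IsHomogeneous e) {x : MvPolynomial σ R} (hx : x.IsHomogeneous k)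
    (h : x ∈ Ideal.span (Set.range q)) (hk : k < e) : x = 0 := by
  obtain ⟨c, rfl⟩ := Finsupp.mem_ideal_span_range_iff_exists_finsupp.1 h
  rw [← homogeneousComponent_eq_self hx, Finsupp.sum, map_sum]
  exact Finset.sum_eq_zero fun i _ => homogeneousComponent_mul_of_lt (hq i) _ hk

theorem exists_isHomogeneous_sum_eq_of_mem_span {ι : Type*} [Fintype ι] {q : ι → MvPolynomial σ R}
    {k : ℕ} (hq : ∀ i, (q i).IsHomogeneous e) {x : MvPolynomial σ R} (hx : x.IsHomogeneous (k + e))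
    (h : x ∈ Ideal.span (Set.range q)) :
    ∃ a : ι → MvPolynomial σ R, (∀ i, (a i).IsHomogeneous k) ∧ ∑ i, a i * q i = x := by
  obtain ⟨c, rfl⟩ := Ideal.mem_span_range_iff_exists_fun.1 h
  refine ⟨fun i => homogeneousComponent k (c i),
    fun i => homogeneousComponent_isHomogeneous _ _, ?_⟩
  conv_rhs => rw [← homogeneousComponent_eq_self hx, map_sum]
  exact Finset.sum_congr rfl fun i _ => (homogeneousComponent_add_mul (hq i) _ _).symm

theorem mem_idealOfVars_iff : p ∈ idealOfVars σ R ↔ constantCoeff p = 0 := by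
  rw [← pow_one (idealOfVars σ R), mem_pow_idealOfVars_iff', constantCoeff_eq]
  refine ⟨fun h => h 0 (by simp), fun h m hm => ?_⟩
  rwa [(Finsupp.degree_eq_zero_iff m).1 (Nat.lt_one_iff.1 hm)]

theorem mem_idealOfVars_pow_of_isHomogeneous {N : ℕ} (hp : p.IsHomogeneous e) (h : N ≤ e) :
    p ∈ idealOfVars σ R ^ N := by
  refine (mem_pow_idealOfVars_iff' N p).2 fun m hm => hp.coeff_eq_zero ?_
  exact (hm.trans_le h).ne

theorem mem_idealOfVars_of_isHomogeneous (hp : p.IsHomogeneous (e + 1)) : p ∈ idealOfVars σ R := by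
  simpa using mem_idealOfVars_pow_of_isHomogeneous hp (Nat.le_add_left 1 e)

theorem homogeneousComponent_eq_zero_of_mem {k N : ℕ} (hp : p ∈ idealOfVars σ R ^ N) (h : k < N) :
    homogeneousComponent k p = 0 := by
  ext m
  rw [coeff_homogeneousComponent, coeff_zero]
  split_ifs with hm
  · exact (mem_pow_idealOfVars_iff' N p).1 hp m (by omega)
  · rfl

theorem isHomogeneous_span_image {ι : Type*} {q : ι → MvPolynomial σ R} {d : ι → ℕ}
    (hq : ∀ i, (q i).IsHomogeneous (d i)) (T : Set ι) :
    (Ideal.span (q '' T)).IsHomogeneous (homogeneousSubmodule σ R) :=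
  Ideal.homogeneous_span _ _ (Set.forall_mem_image.2 fun i _ => ⟨d i, hq i⟩)

theorem isHomogeneous_span_range {ι : Type*} {q : ι → MvPolynomial σ R} {d : ι → ℕ}
    (hq : ∀ i, (q i).IsHomogeneous (d i)) :
    (Ideal.span (Set.range q)).IsHomogeneous (homogeneousSubmodule σ R) := by
  simpa only [Set.image_univ] using isHomogeneous_span_image hq Set.univ

theorem isHomogeneous_sup_span_singleton {V : Ideal (MvPolynomial σ R)}
    (hV : V.IsHomogeneous (homogeneousSubmodule σ R)) (hp : p.IsHomogeneous e) :
    (V ⊔ Ideal.span {p}).IsHomogeneous (homogeneousSubmodule σ R) :=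
  hV.sup (Ideal.homogeneous_span _ _ (by rintro _ rfl; exact ⟨e, hp⟩))

end CommSemiring

section CommRing

variable [CommRing R] {Q : Ideal (MvPolynomial σ R)} {x p w : MvPolynomial σ R} {k e : ℕ}

theorem exists_isHomogeneous_sub_mul_mem (hQ : Q.IsHomogeneous (homogeneousSubmodule σ R))
    (hx : x.IsHomogeneous (k + e)) (hp : p.IsHomogeneous e) (h : x ∈ Q ⊔ Ideal.span {p}) :
    ∃ c : MvPolynomial σ R, c.IsHomogeneous k ∧ x - c * p ∈ Q := by
  obtain ⟨c, hc⟩ := mem_sup_span_singleton_iff.1 h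
  refine ⟨_, homogeneousComponent_isHomogeneous k c, ?_⟩
  simpa only [map_sub, homogeneousComponent_eq_self hx, homogeneousComponent_add_mul hp] using
    homogeneousComponent_mem_of_mem hQ hc (k + e)

theorem mem_of_mem_sup_span_singleton_of_lt (hQ : Q.IsHomogeneous (homogeneousSubmodule σ R))
    (hx : x.IsHomogeneous k) (hp : p.IsHomogeneous e) (h : x ∈ Q ⊔ Ideal.span {p}) (hk : k < e) :
    x ∈ Q := by
  obtain ⟨c, hc⟩ := mem_sup_span_singleton_iff.1 h
  simpa only [map_sub, homogeneousComponent_eq_self hx, homogeneousComponent_mul_of_lt hp c hk,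
    sub_zero] using homogeneousComponent_mem_of_mem hQ hc k

theorem mem_of_forall_mem_sup_idealOfVars_pow
    (hQ : Q.IsHomogeneous (homogeneousSubmodule σ R))
    (h : ∀ N, x ∈ Q ⊔ idealOfVars σ R ^ N) : x ∈ Q := by
  refine (mem_iff_homogeneousComponent_mem hQ x).2 fun k => ?_
  obtain ⟨v, hv, z, hz, rfl⟩ := Submodule.mem_sup.1 (h (k + 1))
  rw [map_add, homogeneousComponent_eq_zero_of_mem hz k.lt_succ_self, add_zero]
  exact homogeneousComponent_mem_of_mem hQ hv k

theorem isSMulRegular_quotient_of_sup (hQ : Q.IsHomogeneous (homogeneousSubmodule σ R))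
    (hwm : w ∈ idealOfVars σ R) (hw : IsSMulRegular (MvPolynomial σ R ⧸ Q) w)
    (hp : IsSMulRegular (MvPolynomial σ R ⧸ Q ⊔ Ideal.span {w}) p) :
    IsSMulRegular (MvPolynomial σ R ⧸ Q) p := by
  -- An element killed by `p` is a multiple of `w` by another such element, hence, by induction,
  -- lies in every power of the ideal of the variables.
  have hmem : ∀ N x, p * x ∈ Q → x ∈ Q ⊔ idealOfVars σ R ^ N := by
    intro N
    induction N with
    | zero => exact fun x _ => by simp
    | succ N ih =>
      intro x hx
      obtain ⟨y, hy⟩ :=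
        mem_sup_span_singleton_iff.1 (mem_of_mul_mem hp (Ideal.mem_sup_left hx))
      have hpy : p * y ∈ Q := by
        refine mem_of_mul_mem hw ?_
        convert Q.sub_mem hx (Q.mul_mem_left p hy) using 1
        ring
      obtain ⟨v, hv, z, hz, rfl⟩ := Submodule.mem_sup.1 (ih y hpy)
      refine Submodule.mem_sup.2
        ⟨x - (v + z) * w + w * v, Q.add_mem hy (Q.mul_mem_left _ hv), w * z, ?_, by ring⟩
      rw [pow_succ']
      exact Ideal.mul_mem_mul hwm hz
  exact isSMulRegular_quotient_iff.2 fun x hx =>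
    mem_of_forall_mem_sup_idealOfVars_pow hQ fun N => hmem N x hx

theorem isPrime_idealOfVars [IsDomain R] : (idealOfVars σ R).IsPrime := by
  have hker : idealOfVars σ R = RingHom.ker (constantCoeff : MvPolynomial σ R →+* R) :=
    Ideal.ext fun _ => mem_idealOfVars_iff
  rw [hker]
  exact RingHom.ker_isPrime _

theorem isHomogeneous_of_mem_minimalPrimes {I P : Ideal (MvPolynomial σ R)}
    (hI : I.IsHomogeneous (homogeneousSubmodule σ R)) (hP : P ∈ I.minimalPrimes) :
    P.IsHomogeneous (homogeneousSubmodule σ R) := by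
  have hprime := hP.1.1.homogeneousCore (𝒜 := homogeneousSubmodule σ R)
  have hle : I ≤ (P.homogeneousCore (homogeneousSubmodule σ R)).toIdeal := by
    rw [← hI.toIdeal_homogeneousCore_eq_self]
    exact Ideal.homogeneousCore_mono _ hP.1.2
  have hcore := Ideal.toIdeal_homogeneousCore_le (homogeneousSubmodule σ R) P
  rw [le_antisymm (hP.2 ⟨hprime, hle⟩ hcore) hcore]
  exact HomogeneousIdeal.isHomogeneous _

end CommRing

section Field

variable {K : Type*} [Field K]

theorem le_idealOfVars_of_isHomogeneous {P : Ideal (MvPolynomial σ K)}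
    (hP : P.IsHomogeneous (homogeneousSubmodule σ K)) (htop : P ≠ ⊤) : P ≤ idealOfVars σ K := by
  refine fun x hx => mem_idealOfVars_iff.2 ?_
  by_contra hunit
  have hC : C (constantCoeff x) ∈ P := by
    simpa only [homogeneousComponent_zero, constantCoeff_eq] using
      homogeneousComponent_mem_of_mem hP hx 0
  exact htop (P.eq_top_of_isUnit_mem hC ((isUnit_iff_ne_zero.2 hunit).map C))

theorem exists_linear_notMem [Infinite K] {S : Set (Ideal (MvPolynomial σ K))} (hS : S.Finite)
    (h : ∀ P ∈ S, ¬ idealOfVars σ K ≤ P) :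
    ∃ z : MvPolynomial σ K, z.IsHomogeneous 1 ∧ ∀ P ∈ S, z ∉ P := by
  classical
  let E := homogeneousSubmodule σ K 1
  let linearPart : Ideal (MvPolynomial σ K) → Subspace K E := fun P =>
    (P.restrictScalars K).comap E.subtype
  have htop : ⊤ ∉ hS.toFinset.image linearPart := by
    simp only [Finset.mem_image, Set.Finite.mem_toFinset, not_exists, not_and]
    refine fun P hP hPtop => h P hP (Ideal.span_le.2 ?_)
    rintro _ ⟨i, rfl⟩
    have hX : (⟨X i, isHomogeneous_X K i⟩ : E) ∈ linearPart P := hPtop ▸ Submodule.mem_top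
    exact hX
  obtain ⟨z, hz⟩ :=
    (Set.ne_univ_iff_exists_notMem _).1 (Subspace.biUnion_ne_univ_of_top_notMem htop)
  refine ⟨z, z.2, fun P hP hzP => hz (Set.mem_biUnion (x := linearPart P) ?_ hzP)⟩
  exact Finset.mem_image_of_mem _ (hS.mem_toFinset.2 hP)

end Field

end Graded

theorem update_image_of_notMem {ι B : Type*} [DecidableEq ι] (q : ι → B) (p : B) {T : Set ι} {i : ι}
    (hi : i ∉ T) : Function.update q i p '' T = q '' T :=
  Set.image_congr fun _ hj => Function.update_of_ne (ne_of_mem_of_not_mem hj hi) _ _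

section Regular

variable {ι A : Type*} [CommRing A]

/-- A family each of whose members is a nonzerodivisor modulo any set of the other members, that
is, a family which is a regular sequence in every order. -/
def IsRegularFamily (q : ι → A) : Prop :=
  ∀ (T : Set ι) (i : ι), i ∉ T → IsSMulRegular (A ⧸ Ideal.span (q '' T)) (q i)

theorem span_range_update [DecidableEq ι] (q : ι → A) (p : A) (i : ι) :
    Ideal.span (Set.range (Function.update q i p)) =
      Ideal.span (q '' {i}ᶜ) ⊔ Ideal.span {p} := by
  rw [span_range_eq_sup _ i, update_image_of_notMem _ _ (by simp), Function.update_self]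

variable {σ R : Type*} [CommRing R] {q : ι → MvPolynomial σ R} {d : ι → ℕ} {p : MvPolynomial σ R}

theorem IsRegularFamily.isSMulRegular_of_union (hreg : IsRegularFamily q)
    (hq : ∀ i, (q i).IsHomogeneous (d i + 1)) {T D : Set ι} (hD : D.Finite)
    (hp : IsSMulRegular (MvPolynomial σ R ⧸ Ideal.span (q '' (T ∪ D))) p) :
    IsSMulRegular (MvPolynomial σ R ⧸ Ideal.span (q '' T)) p := by
  induction D, hD using Set.Finite.induction_on generalizing T with
  | empty => rwa [Set.union_empty] at hp
  | @insert w D _ _ ih =>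
    rw [Set.union_insert, ← Set.insert_union] at hp
    have hpw := ih hp
    by_cases hw : w ∈ T
    · rwa [Set.insert_eq_of_mem hw] at hpw
    · rw [span_image_insert] at hpw
      exact isSMulRegular_quotient_of_sup (isHomogeneous_span_image hq T)
        (mem_idealOfVars_of_isHomogeneous (hq w)) (hreg T w hw) hpw

theorem IsRegularFamily.update [Finite ι] [DecidableEq ι] (hreg : IsRegularFamily q)
    (hq : ∀ i, (q i).IsHomogeneous (d i + 1)) {i : ι}
    (hp : IsSMulRegular (MvPolynomial σ R ⧸ Ideal.span (q '' {i}ᶜ)) p) :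
    IsRegularFamily (Function.update q i p) := by
  have hpT : ∀ T : Set ι, i ∉ T → IsSMulRegular (MvPolynomial σ R ⧸ Ideal.span (q '' T)) p := by
    intro T hT
    refine hreg.isSMulRegular_of_union hq (D := {i}ᶜ) (Set.toFinite _) ?_
    rwa [Set.union_eq_self_of_subset_left (Set.subset_compl_singleton_iff.2 hT)]
  intro T j hj
  by_cases hi : i ∈ T
  · have hT : insert i (T \ {i}) = T := by rw [Set.insert_sdiff_singleton, Set.insert_eq_of_mem hi]
    have hiT : i ∉ T \ {i} := Set.notMem_sdiff_of_mem rfl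
    have hji : j ≠ i := (ne_of_mem_of_not_mem hi hj).symm
    rw [← hT, span_image_insert, update_image_of_notMem _ _ hiT, Function.update_self,
      Function.update_of_ne hji]
    refine isSMulRegular_quotient_swap (hreg _ j fun h => hj h.1) ?_
    rw [← span_image_insert]
    exact hpT _ (by simp [hji.symm])
  · rw [update_image_of_notMem _ _ hi]
    by_cases hji : j = i
    · rw [hji, Function.update_self]
      exact hpT T hi
    · rw [Function.update_of_ne hji]
      exact hreg T j hj

theorem isRegularFamily_X : IsRegularFamily (X : σ → MvPolynomial σ R) := by
  refine fun T i hi => isSMulRegular_quotient_iff.2 fun x hx => ?_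
  rw [mem_ideal_span_X_image] at hx ⊢
  intro m hm
  obtain ⟨j, hj, hmj⟩ := hx (m + Finsupp.single i 1) (by
    rwa [mem_support_iff, mul_comm, coeff_mul_X, ← mem_support_iff])
  have hij : i ≠ j := (ne_of_mem_of_not_mem hj hi).symm
  exact ⟨j, hj, by simpa [Finsupp.single_apply, hij] using hmj⟩

end Regular

section ParameterSystems

variable {σ K : Type*} [Field K] {d d' : σ → ℕ} {q q' : σ → MvPolynomial σ K}

/-- A homogeneous system of parameters of `K[σ]`, indexed by the variables. The degree of `q i` is
`d i + 1`, so that all degrees are positive and `∑ i, d i` is the socle degree of the quotient. -/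
structure IsParameterSystem (d : σ → ℕ) (q : σ → MvPolynomial σ K) : Prop where
  isHomogeneous : ∀ i, (q i).IsHomogeneous (d i + 1)
  exists_pow_le : ∃ N, idealOfVars σ K ^ N ≤ Ideal.span (Set.range q)

/-- A regular family whose quotient is Gorenstein, with its socle in the degree `∑ i, d i`. -/
structure IsGorensteinFamily [Fintype σ] (d : σ → ℕ) (q : σ → MvPolynomial σ K) : Prop where
  regular : IsRegularFamily q
  exists_socle : ∃ s : MvPolynomial σ K, s.IsHomogeneous (∑ i, d i) ∧
    IsSocleGenerator (Ideal.span (Set.range q)) s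

theorem IsParameterSystem.span_range_le_idealOfVars (hq : IsParameterSystem d q) :
    Ideal.span (Set.range q) ≤ idealOfVars σ K :=
  Ideal.span_le.2 (Set.forall_mem_range.2 fun i =>
    mem_idealOfVars_of_isHomogeneous (hq.isHomogeneous i))

theorem IsSocleGenerator.exists_isHomogeneous_of_mul {U : Ideal (MvPolynomial σ K)}
    {a p s : MvPolynomial σ K} {b c e : ℕ} (hU : U.IsHomogeneous (homogeneousSubmodule σ K))
    (ha : a.IsHomogeneous c) (hp : p.IsHomogeneous e)
    (hs : s.IsHomogeneous (b + c)) (haU : IsSMulRegular (MvPolynomial σ K ⧸ U) a)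
    (htop : U ⊔ Ideal.span {p} ≠ ⊤) (hsoc : IsSocleGenerator (U ⊔ Ideal.span {a * p}) s) :
    ∃ y : MvPolynomial σ K, y.IsHomogeneous b ∧ IsSocleGenerator (U ⊔ Ideal.span {p}) y := by
  have ha_notMem : a ∉ U ⊔ Ideal.span {a * p} := by
    intro h
    obtain ⟨c, hc⟩ := mem_sup_span_singleton_iff.1 h
    refine htop ((Ideal.eq_top_iff_one _).2 (mem_sup_span_singleton_iff.2
      ⟨c, mem_of_mul_mem haU ?_⟩))
    convert hc using 1
    ring
  obtain ⟨y, hy, hsy⟩ := exists_isHomogeneous_sub_mul_mem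
    (isHomogeneous_sup_span_singleton hU (ha.mul hp)) hs ha (hsoc.2 a ha_notMem)
  exact ⟨y, hy, hsoc.of_mul haU hsy⟩

theorem IsParameterSystem.mem_minimalPrimes_of_lt [Finite σ] (hq : IsParameterSystem d q)
    {i : σ} {P : Ideal (MvPolynomial σ K)} [P.IsPrime] (hP : P < idealOfVars σ K)
    (hqP : q '' {i}ᶜ ⊆ P) : P ∈ (Ideal.span (q '' {i}ᶜ)).minimalPrimes := by
  obtain ⟨N, hN⟩ := hq.exists_pow_le
  have hspan : Ideal.span (insert (q i) (q '' {i}ᶜ)) = Ideal.span (Set.range q) := by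
    rw [span_range_eq_sup q i, Ideal.span_insert, sup_comm]
  have hmin : idealOfVars σ K ∈ (Ideal.span (insert (q i) (q '' {i}ᶜ))).minimalPrimes := by
    rw [hspan]
    exact ⟨⟨isPrime_idealOfVars, hq.span_range_le_idealOfVars⟩,
      fun J hJ _ => hJ.1.le_of_pow_le (hN.trans hJ.2)⟩
  refine Ideal.mem_minimalPrimes_span_of_mem_minimalPrimes_span_insert hP (q i) _ hmin _ hqP ?_
  exact fun x hx => Ideal.le_radical (Ideal.subset_span (Set.mem_insert_of_mem _ hx))

section Update

variable [DecidableEq σ] {i : σ} {p : MvPolynomial σ K} {e : ℕ}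

theorem IsParameterSystem.update (hq : IsParameterSystem d q) (hp : p.IsHomogeneous (e + 1))
    (hpow : ∃ N, idealOfVars σ K ^ N ≤ Ideal.span (q '' {i}ᶜ) ⊔ Ideal.span {p}) :
    IsParameterSystem (Function.update d i e) (Function.update q i p) := by
  refine ⟨fun j => ?_, by rwa [span_range_update]⟩
  by_cases hj : j = i
  · rwa [hj, Function.update_self, Function.update_self]
  · simpa only [Function.update_of_ne hj] using hq.isHomogeneous j

theorem IsParameterSystem.exists_pow_sub_mul_mem (hq : IsParameterSystem d q)
    (hp : IsParameterSystem (Function.update d i e) (Function.update q i p)) :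
    ∃ (k c : ℕ) (a : MvPolynomial σ K), c + (e + 1) = (k + 1) * (d i + 1) ∧ a.IsHomogeneous c ∧
      q i ^ (k + 1) - a * p ∈ Ideal.span (q '' {i}ᶜ) := by
  obtain ⟨N, hN⟩ := hp.exists_pow_le
  have hpe : p.IsHomogeneous (e + 1) := by simpa using hp.isHomogeneous i
  have hle : N + e + 1 ≤ (N + e + 1) * (d i + 1) := Nat.le_mul_of_pos_right _ (d i).succ_pos
  obtain ⟨c, hc⟩ : ∃ c, (N + e + 1) * (d i + 1) = c + (e + 1) :=
    Nat.exists_eq_add_of_le' (by omega)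
  have hqi : (q i ^ (N + e + 1)).IsHomogeneous (c + (e + 1)) := by
    rw [← hc, mul_comm]
    exact (hq.isHomogeneous i).pow _
  have hmem := hN (mem_idealOfVars_pow_of_isHomogeneous hqi (by omega))
  rw [span_range_update] at hmem
  obtain ⟨a, ha, hap⟩ := exists_isHomogeneous_sub_mul_mem
    (isHomogeneous_span_image hq.isHomogeneous {i}ᶜ) hqi hpe hmem
  exact ⟨N + e, c, a, hc.symm, ha, hap⟩

theorem IsGorensteinFamily.update [Fintype σ] (hG : IsGorensteinFamily d q)
    (hq : IsParameterSystem d q)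
    (hp : IsParameterSystem (Function.update d i e) (Function.update q i p)) :
    IsGorensteinFamily (Function.update d i e) (Function.update q i p) := by
  obtain ⟨k, c, a, hkc, ha, hap⟩ := hq.exists_pow_sub_mul_mem hp
  obtain ⟨s, hs, hsoc⟩ := hG.exists_socle
  set U := Ideal.span (q '' {i}ᶜ)
  have hUhom := isHomogeneous_span_image hq.isHomogeneous {i}ᶜ
  have hpe : p.IsHomogeneous (e + 1) := by simpa using hp.isHomogeneous i
  have hqU : IsSMulRegular (MvPolynomial σ K ⧸ U) (q i) := hG.regular _ i (by simp)
  obtain ⟨haU, hpU⟩ := IsSMulRegular.mul_iff.1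
    (isSMulRegular_quotient_of_sub_mem hap (hqU.pow (k + 1)))
  have htop : U ⊔ Ideal.span {p} ≠ ⊤ := by
    rw [← span_range_update]
    exact ne_top_of_le_ne_top isPrime_idealOfVars.ne_top hp.span_range_le_idealOfVars
  have hpow : IsSocleGenerator (U ⊔ Ideal.span {a * p}) (q i ^ k * s) := by
    rw [← sup_span_singleton_eq_of_sub_mem hap]
    exact IsSocleGenerator.pow_mul (span_range_eq_sup q i ▸ hsoc) hqU k
  have hsum : ∑ j, d j = d i + ∑ j ∈ Finset.univ \ {i}, d j := by
    rw [← Finset.sum_update_of_mem (Finset.mem_univ i), Function.update_eq_self]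
  have hsum' := Finset.sum_update_of_mem (Finset.mem_univ i) d e
  have hdeg : (q i ^ k * s).IsHomogeneous (∑ j, Function.update d i e j + c) := by
    convert ((hq.isHomogeneous i).pow k).mul hs using 1
    linarith
  refine ⟨hG.regular.update hq.isHomogeneous hpU, ?_⟩
  rw [span_range_update]
  exact hpow.exists_isHomogeneous_of_mul hUhom ha hpe hdeg haU htop

theorem IsParameterSystem.update_linear [Finite σ] (hq : IsParameterSystem d q)
    (hp : p.IsHomogeneous 1)
    (hpP : ∀ P ∈ (Ideal.span (q '' {i}ᶜ)).minimalPrimes, ¬ idealOfVars σ K ≤ P → p ∉ P) :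
    IsParameterSystem (Function.update d i 0) (Function.update q i p) := by
  refine hq.update hp (Ideal.exists_pow_le_of_le_radical_of_fg ?_ (idealOfVars_fg σ K))
  rw [← Ideal.sInf_minimalPrimes]
  refine le_sInf fun P hP => ?_
  by_contra hle
  have hprime := hP.1.1
  have hhom := isHomogeneous_of_mem_minimalPrimes (isHomogeneous_sup_span_singleton
    (isHomogeneous_span_image hq.isHomogeneous {i}ᶜ) hp) hP
  have hlt : P < idealOfVars σ K :=
    (le_idealOfVars_of_isHomogeneous hhom hprime.ne_top).lt_of_not_ge hle
  refine hpP P (hq.mem_minimalPrimes_of_lt hlt ?_) hle ?_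
  · exact fun x hx => hP.1.2 (Ideal.mem_sup_left (Ideal.subset_span hx))
  · exact hP.1.2 (Ideal.mem_sup_right (Ideal.mem_span_singleton_self p))

theorem IsParameterSystem.exists_update_linear [Infinite K] [Finite σ]
    (hq : IsParameterSystem d q) (hq' : IsParameterSystem d' q') (i : σ) :
    ∃ z : MvPolynomial σ K,
      IsParameterSystem (Function.update d i 0) (Function.update q i z) ∧
      IsParameterSystem (Function.update d' i 0) (Function.update q' i z) := by
  have hfin := (Ideal.finite_minimalPrimes_of_isNoetherianRing _ (Ideal.span (q '' {i}ᶜ))).union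
    (Ideal.finite_minimalPrimes_of_isNoetherianRing _ (Ideal.span (q' '' {i}ᶜ)))
  obtain ⟨z, hz, hzP⟩ := exists_linear_notMem
    (hfin.sep fun P => ¬ idealOfVars σ K ≤ P) fun _ hP => hP.2
  exact ⟨z, hq.update_linear hz fun P hP hle => hzP P ⟨Or.inl hP, hle⟩,
    hq'.update_linear hz fun P hP hle => hzP P ⟨Or.inr hP, hle⟩⟩

end Update

theorem isParameterSystem_X : IsParameterSystem (fun _ => 0) (X : σ → MvPolynomial σ K) :=
  ⟨isHomogeneous_X K, 1, (pow_one _).le⟩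

theorem isSocleGenerator_idealOfVars_one : IsSocleGenerator (idealOfVars σ K) 1 := by
  refine ⟨fun h => by simp [mem_idealOfVars_iff] at h, fun x hx => ?_⟩
  rw [mem_idealOfVars_iff] at hx
  exact mem_sup_span_singleton_iff.2
    ⟨C (constantCoeff x)⁻¹, mem_idealOfVars_iff.2 (by simp [inv_mul_cancel₀ hx])⟩

theorem isGorensteinFamily_X [Fintype σ] :
    IsGorensteinFamily (fun _ => 0) (X : σ → MvPolynomial σ K) :=
  ⟨isRegularFamily_X, 1, by simpa using isHomogeneous_one σ K, isSocleGenerator_idealOfVars_one⟩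

-- The members of the two families are exchanged one at a time, through a linear form which is a
-- parameter for both of them.
theorem IsGorensteinFamily.of_eq_off [Infinite K] [Fintype σ] (hG : IsGorensteinFamily d q)
    (hq : IsParameterSystem d q) (hq' : IsParameterSystem d' q') (S : Finset σ)
    (h : ∀ j ∉ S, d j = d' j ∧ q j = q' j) : IsGorensteinFamily d' q' := by
  classical
  induction S using Finset.induction_on generalizing d d' q q' with
  | empty =>
    obtain rfl : d = d' := _root_.funext fun j => (h j (Finset.notMem_empty j)).1
    obtain rfl : q = q' := _root_.funext fun j => (h j (Finset.notMem_empty j)).2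
    exact hG
  | insert i S _ ih =>
    obtain ⟨z, hz, hz'⟩ := hq.exists_update_linear hq' i
    have hGz' := ih (hG.update hq hz) hz hz' fun j hj => by
      by_cases hji : j = i
      · simp [hji]
      · simpa [hji] using h j (by simp [hji, hj])
    have hback : IsParameterSystem (Function.update (Function.update d' i 0) i (d' i))
        (Function.update (Function.update q' i z) i (q' i)) := by simpa using hq'
    simpa using hGz'.update hz' hback

theorem IsParameterSystem.isGorensteinFamily [Infinite K] [Fintype σ]
    (hq : IsParameterSystem d q) : IsGorensteinFamily d q :=
  isGorensteinFamily_X.of_eq_off isParameterSystem_X hq Finset.univ (by simp)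

end ParameterSystems

section Duality

theorem exists_apply_ne_zero_of_dualCoannihilator_le {K U E : Type*} [Field K] [AddCommGroup U]
    [Module K U] [AddCommGroup E] [Module K E] [FiniteDimensional K E]
    {F : U →ₗ[K] Module.Dual K E} {W : Subspace K E}
    (hW : (LinearMap.range F).dualCoannihilator ≤ W) {x : E} (hx : x ∉ W) :
    ∃ u, (∀ w ∈ W, F u w = 0) ∧ F u x ≠ 0 := by
  obtain ⟨φ, hφx, hφW⟩ := Submodule.exists_le_ker_of_notMem hx
  have hφ : φ ∈ LinearMap.range F := by
    rw [← Subspace.dualCoannihilator_dualAnnihilator_eq (W := LinearMap.range F)]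
    exact Submodule.dualAnnihilator_anti hW
      ((Submodule.mem_dualAnnihilator φ).2 fun w hw => hφW hw)
  obtain ⟨u, rfl⟩ := hφ
  exact ⟨u, fun w hw => hφW hw, hφx⟩

variable {σ K : Type*} [Field K] {Q : Ideal (MvPolynomial σ K)} {s p x : MvPolynomial σ K}
  {a b e : ℕ}

theorem IsSocleGenerator.exists_isHomogeneous_sub_mul_mem (hsoc : IsSocleGenerator Q s)
    (hQ : Q.IsHomogeneous (homogeneousSubmodule σ K)) (hs : s.IsHomogeneous b)
    (hx : x.IsHomogeneous a) (hxQ : x ∉ Q) :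
    ∃ (i : ℕ) (y : MvPolynomial σ K), i + a = b ∧ y.IsHomogeneous i ∧ s - y * x ∈ Q := by
  have hmem := hsoc.2 x hxQ
  have hab : a ≤ b := by
    by_contra! hlt
    exact hsoc.1 (mem_of_mem_sup_span_singleton_of_lt hQ hs hx hmem hlt)
  obtain ⟨i, rfl⟩ := Nat.exists_eq_add_of_le' hab
  obtain ⟨y, hy, hyx⟩ := JacobianModule.exists_isHomogeneous_sub_mul_mem hQ hs hx hmem
  exact ⟨i, y, rfl, hy, hyx⟩

-- The pairing `(u, x) ↦ τ (u * x)`, for a linear form `τ` on `K[σ] ⧸ Q` with `τ s ≠ 0`, is perfect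
-- between complementary degrees, and the ideal generated by `p` is the orthogonal of its
-- annihilator.
theorem IsSocleGenerator.mem_sup_of_forall_mul_mem [Finite σ] (hsoc : IsSocleGenerator Q s)
    (hQ : Q.IsHomogeneous (homogeneousSubmodule σ K)) (hs : s.IsHomogeneous b)
    (hp : p.IsHomogeneous e) (hx : x.IsHomogeneous a)
    (h : ∀ (i : ℕ) (u : MvPolynomial σ K), i + a = b → u.IsHomogeneous i →
      p * u ∈ Q → x * u ∈ Q) : x ∈ Q ⊔ Ideal.span {p} := by
  by_contra hxW
  obtain ⟨i, -, hia, -⟩ := hsoc.exists_isHomogeneous_sub_mul_mem hQ hs hx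
    fun hxQ => hxW (Ideal.mem_sup_left hxQ)
  obtain ⟨τ, hτs, hτQ⟩ := Submodule.exists_le_ker_of_notMem
    (show s ∉ Q.restrictScalars K from hsoc.1)
  have hτ_ne : ∀ z, s - z ∈ Q → τ z ≠ 0 := fun z hz h0 =>
    hτs (by simpa [h0] using show τ (s - z) = 0 from hτQ hz)
  let E := homogeneousSubmodule σ K a
  have : FiniteDimensional K E := Module.Finite.iff_fg.2 (homogeneousSubmodule_fg σ K a)
  let F : homogeneousSubmodule σ K i →ₗ[K] Module.Dual K E :=
    ((LinearMap.mul K _).compr₂ τ).domRestrict₁₂ _ _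
  let W : Subspace K E := ((Q ⊔ Ideal.span {p}).restrictScalars K).comap E.subtype
  have hW : (LinearMap.range F).dualCoannihilator ≤ W := by
    intro y hy
    by_contra hyW
    obtain ⟨i', u, hi', hu, hsu⟩ := hsoc.exists_isHomogeneous_sub_mul_mem hQ hs y.2
      fun hyQ => hyW (Ideal.mem_sup_left hyQ)
    obtain rfl : i' = i := by omega
    exact hτ_ne _ hsu ((Submodule.mem_dualCoannihilator y).1 hy _ ⟨⟨u, hu⟩, rfl⟩)
  obtain ⟨⟨u, hu⟩, hFW, hFx⟩ := exists_apply_ne_zero_of_dualCoannihilator_le (F := F) hW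
    (show (⟨x, hx⟩ : E) ∉ W from hxW)
  have hpu : p * u ∈ Q := by
    by_contra hpu
    obtain ⟨k, y, hk, hy, hsy⟩ := hsoc.exists_isHomogeneous_sub_mul_mem hQ hs (hp.mul hu) hpu
    have hyp : (y * p).IsHomogeneous a := by
      convert hy.mul hp using 1
      omega
    have hypW : τ (u * (y * p)) = 0 := hFW ⟨y * p, hyp⟩
      (Ideal.mem_sup_right (Ideal.mul_mem_left _ _ (Ideal.mem_span_singleton_self p)))
    exact hτ_ne _ hsy (by convert hypW using 2; ring)
  have hux : u * x ∈ Q := by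
    rw [mul_comm]
    exact h i u hia hu hpu
  exact hFx (hτQ hux)

end Duality

section Zeros

variable {σ ι K : Type*} [Field K]

theorem exists_pow_idealOfVars_le [IsAlgClosed K] [Finite σ] {q : ι → MvPolynomial σ K}
    (h : ∀ v : σ → K, (∀ i, eval v (q i) = 0) → v = 0) :
    ∃ N, idealOfVars σ K ^ N ≤ Ideal.span (Set.range q) := by
  refine Ideal.exists_pow_le_of_le_radical_of_fg ?_ (idealOfVars_fg σ K)
  rw [← vanishingIdeal_zeroLocus_eq_radical (K := K), idealOfVars, Ideal.span_le]
  rintro _ ⟨i, rfl⟩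
  rw [SetLike.mem_coe, mem_vanishingIdeal_iff]
  intro v hv
  rw [h v fun j => by simpa [aeval_eq_eval] using hv _ (Ideal.subset_span ⟨j, rfl⟩)]
  simp

theorem eval_smul_of_isHomogeneous {R : Type*} [CommSemiring R] {q : MvPolynomial σ R} {e : ℕ}
    (hq : q.IsHomogeneous e) (c : R) (v : σ → R) :
    eval (c • v) q = c ^ e * eval v q := by
  rw [eval_eq, eval_eq, Finset.mul_sum]
  refine Finset.sum_congr rfl fun m hm => ?_
  have hdeg : ∑ i ∈ m.support, m i = e := by
    rw [← Finsupp.degree_apply, Finsupp.degree_eq_weight_one]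
    exact hq (mem_support_iff.1 hm)
  simp only [Pi.smul_apply, smul_eq_mul, mul_pow, Finset.prod_mul_distrib,
    Finset.prod_pow_eq_pow_sum, hdeg]
  ring

theorem exists_forall_eval_ne [Infinite K] [Fintype σ] [Fintype ι]
    (hcard : Fintype.card σ < Fintype.card ι) (F : ι → MvPolynomial σ K) :
    ∃ p : ι → K, ∀ v, (fun i => eval v (F i)) ≠ p := by
  have hdep : ¬ AlgebraicIndependent K F := by
    intro hind
    have hle := hind.lift_cardinalMk_le_trdeg
    rw [trdeg_of_isDomain] at hle
    simp only [Cardinal.mk_fintype, Cardinal.lift_natCast, Nat.cast_le] at hle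
    omega
  obtain ⟨P, hP, hP0⟩ : ∃ P, aeval F P = 0 ∧ P ≠ 0 := by
    rw [algebraicIndependent_iff] at hdep
    push Not at hdep
    exact hdep
  obtain ⟨p, hp⟩ : ∃ p, eval p P ≠ 0 := by
    by_contra! h
    exact hP0 (MvPolynomial.funext fun x => by rw [h, map_zero])
  refine ⟨p, fun v hv => hp ?_⟩
  have heval : (aeval v).comp (aeval F) = aeval (R := K) p := by
    ext i
    simpa [aeval_eq_eval] using congrFun hv i
  have h := DFunLike.congr_fun heval P
  rw [AlgHom.comp_apply, hP, map_zero] at h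
  exact h.symm

-- The polynomials `F i` define a morphism to the projective space of dimension `n`, whose image is
-- a proper subvariety; they are projected from a point outside this image.
theorem exists_isParameterSystem_sub [IsAlgClosed K] {n e : ℕ}
    {F : Fin (n + 1) → MvPolynomial (Fin n) K} (hF : ∀ i, (F i).IsHomogeneous (e + 1))
    (h : ∀ v : Fin n → K, (∀ i, eval v (F i) = 0) → v = 0) :
    ∃ (i₀ : Fin (n + 1)) (c : Fin n → K), IsParameterSystem (fun _ => e)
      fun j => F (i₀.succAbove j) - C (c j) * F i₀ := by
  obtain ⟨p, hp⟩ := exists_forall_eval_ne (by simp) F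
  obtain ⟨i₀, hi₀⟩ : ∃ i, p i ≠ 0 := by
    by_contra! hp0
    refine hp 0 (_root_.funext fun i => ?_)
    have hF0 := eval_smul_of_isHomogeneous (hF i) 0 (0 : Fin n → K)
    rw [smul_zero, zero_pow e.succ_ne_zero, zero_mul] at hF0
    rw [hF0, hp0]
  refine ⟨i₀, fun j => p (i₀.succAbove j) / p i₀, fun j => (hF _).sub ((hF i₀).C_mul _),
    exists_pow_idealOfVars_le fun v hv => h v ?_⟩
  set t := eval v (F i₀) / p i₀
  have hvt : ∀ i, eval v (F i) = t * p i := by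
    intro i
    induction i using Fin.succAboveCases i₀ with
    | x => exact (div_mul_cancel₀ _ hi₀).symm
    | p j =>
      have hj := hv j
      simp only [map_sub, map_mul, eval_C, sub_eq_zero] at hj
      rw [hj]
      ring
  by_cases ht : t = 0
  · intro i
    rw [hvt, ht, zero_mul]
  · obtain ⟨z, hz⟩ := IsAlgClosed.exists_pow_nat_eq t⁻¹ e.succ_pos
    refine absurd (_root_.funext fun i => ?_) (hp (z • v))
    rw [eval_smul_of_isHomogeneous (hF i), hz, hvt, inv_mul_cancel_left₀ ht]

end Zeros

section Restriction

variable {m n : ℕ} {ℓ : Module.Dual ℂ (Fin m → ℂ)}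

theorem linearForm_ne_zero (hℓ : ℓ ≠ 0) : linearForm ℓ ≠ 0 := by
  intro h
  refine hℓ (LinearMap.ext fun v => ?_)
  rw [← eval_linearForm, h, map_zero, LinearMap.zero_apply]

/-- The restriction of polynomials to the hyperplane `ℓ = 0`, in the linear coordinates given by
a basis `b` of the kernel of `ℓ`. By definition, `restrict b f` is `hyperplaneSection f ℓ b`. -/
noncomputable def restrict (b : Module.Basis (Fin n) ℂ (LinearMap.ker ℓ)) :
    MvPolynomial (Fin m) ℂ →ₐ[ℂ] MvPolynomial (Fin n) ℂ :=
  aeval fun i => ∑ j, C ((b j : Fin m → ℂ) i) * X j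

/-- The extension of polynomials on the span of all but the first of the vectors of a basis `B`,
which are constant in the direction of the first vector. It is a section of `restrict b` when the
other vectors are those of `b`. -/
noncomputable def extend (B : Module.Basis (Fin (n + 1)) ℂ (Fin m → ℂ)) :
    MvPolynomial (Fin n) ℂ →ₐ[ℂ] MvPolynomial (Fin m) ℂ :=
  aeval fun j => linearForm (B.coord j.succ)

variable (b : Module.Basis (Fin n) ℂ (LinearMap.ker ℓ))
  {B : Module.Basis (Fin (n + 1)) ℂ (Fin m → ℂ)}

theorem isHomogeneous_restrict {q : MvPolynomial (Fin m) ℂ} {k : ℕ} (hq : q.IsHomogeneous k) :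
    (restrict b q).IsHomogeneous k := by
  rw [← one_mul k]
  exact hq.aeval _ fun i => .sum _ _ _ fun j _ => (isHomogeneous_X ℂ j).C_mul _

theorem isHomogeneous_extend {u : MvPolynomial (Fin n) ℂ} {k : ℕ} (hu : u.IsHomogeneous k) :
    (extend B u).IsHomogeneous k := by
  rw [← one_mul k]
  exact hu.aeval _ fun j => linearForm_isHomogeneous _

theorem eval_restrict (y : Fin n → ℂ) (q : MvPolynomial (Fin m) ℂ) :
    eval y (restrict b q) = eval (∑ j, y j • (b j : Fin m → ℂ)) q := by
  induction q using MvPolynomial.induction_on with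
  | C a => simp [restrict]
  | add p q hp hq => simp [hp, hq]
  | mul_X p i hp =>
    rw [map_mul, map_mul, map_mul, hp]
    simp [restrict, mul_comm]

theorem restrict_linearForm (φ : Module.Dual ℂ (Fin m → ℂ)) :
    restrict b (linearForm φ) = ∑ j, C (φ (b j)) * X j := by
  refine MvPolynomial.funext fun y => ?_
  rw [eval_restrict, eval_linearForm]
  simp [mul_comm]

theorem restrict_linearForm_self : restrict b (linearForm ℓ) = 0 := by
  rw [restrict_linearForm]
  exact Finset.sum_eq_zero fun j _ => by rw [LinearMap.mem_ker.1 (b j).2, C_0, zero_mul]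

theorem exists_basis_extending (hℓ : ℓ ≠ 0) :
    ∃ B : Module.Basis (Fin (n + 1)) ℂ (Fin m → ℂ), B.coord 0 = ℓ ∧ ∀ j, B j.succ = b j := by
  obtain ⟨v, hv⟩ : ∃ v, ℓ v = 1 := by
    obtain ⟨u, hu⟩ := DFunLike.ne_iff.1 hℓ
    exact ⟨(ℓ u)⁻¹ • u, by rw [map_smul, smul_eq_mul, inv_mul_cancel₀ hu]⟩
  let B := Module.Basis.mkFinCons v b
    (fun c x hx h => by simpa [hv, LinearMap.mem_ker.1 hx] using congrArg ℓ h)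
    fun z => ⟨-ℓ z, by simp [hv]⟩
  have hB : ∀ j, B j = (Fin.cons v fun j => (b j : Fin m → ℂ) : Fin (n + 1) → _) j := fun j =>
    congrFun (Module.Basis.coe_mkFinCons ..) j
  refine ⟨B, B.ext fun j => ?_, fun j => by rw [hB, Fin.cons_succ]⟩
  rw [B.coord_apply, B.repr_self, hB]
  induction j using Fin.cases with
  | zero => simp [hv]
  | succ j => simp [LinearMap.mem_ker.1 (b j).2]

variable {b}

theorem restrict_extend (hB : ∀ j, B j.succ = b j) (u : MvPolynomial (Fin n) ℂ) :
    restrict b (extend B u) = u := by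
  have h : (restrict b).comp (extend B) = AlgHom.id ℂ _ := by
    ext1 j
    simp [extend, restrict_linearForm, ← hB, Finsupp.single_apply]
  exact DFunLike.congr_fun h u

theorem X_eq_add_sum_linearForm (B : Module.Basis (Fin (n + 1)) ℂ (Fin m → ℂ)) (i : Fin m) :
    X i = linearForm (B.coord 0) * C (B 0 i) +
      ∑ j : Fin n, linearForm (B.coord j.succ) * C (B j.succ i) := by
  refine MvPolynomial.funext fun w => ?_
  have hw := congrFun (B.sum_repr w) i
  rw [Fin.sum_univ_succ] at hw
  simpa [eval_linearForm] using hw.symm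

theorem sub_extend_restrict_mem (hB₀ : B.coord 0 = ℓ) (hB : ∀ j, B j.succ = b j)
    (x : MvPolynomial (Fin m) ℂ) :
    x - extend B (restrict b x) ∈ Ideal.span {linearForm ℓ} := by
  let mk := Ideal.Quotient.mkₐ ℂ (Ideal.span {linearForm ℓ})
  have h : mk = mk.comp ((extend B).comp (restrict b)) := by
    ext1 i
    refine Ideal.Quotient.eq.2 (Ideal.mem_span_singleton'.2 ⟨C (B 0 i), ?_⟩)
    nth_rw 1 [X_eq_add_sum_linearForm B i, hB₀]
    simp [extend, restrict, hB, mul_comm]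
  exact Ideal.Quotient.eq.1 (DFunLike.congr_fun h x)

theorem exists_isHomogeneous_restrict_eq (hℓ : ℓ ≠ 0) {k : ℕ} {u : MvPolynomial (Fin n) ℂ}
    (hu : u.IsHomogeneous k) :
    ∃ U : MvPolynomial (Fin m) ℂ, U.IsHomogeneous k ∧ restrict b U = u := by
  obtain ⟨B, -, hB⟩ := exists_basis_extending b hℓ
  exact ⟨extend B u, isHomogeneous_extend hu, restrict_extend hB u⟩

theorem ker_restrict (hℓ : ℓ ≠ 0) : RingHom.ker (restrict b) = Ideal.span {linearForm ℓ} := by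
  obtain ⟨B, hB₀, hB⟩ := exists_basis_extending b hℓ
  refine le_antisymm (fun x hx => ?_) ((Ideal.span_singleton_le_iff_mem _).2 ?_)
  · simpa [RingHom.mem_ker.1 hx] using sub_extend_restrict_mem hB₀ hB x
  · exact restrict_linearForm_self b

theorem comap_map_restrict (hℓ : ℓ ≠ 0) (Q : Ideal (MvPolynomial (Fin m) ℂ)) :
    (Q.map (restrict b)).comap (restrict b) = Q ⊔ Ideal.span {linearForm ℓ} := by
  obtain ⟨B, -, hB⟩ := exists_basis_extending b hℓ
  rw [← ker_restrict (b := b) hℓ]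
  exact Ideal.comap_map_of_surjective' _ (fun u => ⟨_, restrict_extend hB u⟩) Q

end Restriction

section DirectionalDerivative

variable {m n : ℕ} {f : MvPolynomial (Fin m) ℂ}

/-- The derivative of `f` in the direction `w`, as a linear function of `w`. -/
noncomputable def dirDeriv (f : MvPolynomial (Fin m) ℂ) :
    (Fin m → ℂ) →ₗ[ℂ] MvPolynomial (Fin m) ℂ :=
  Fintype.linearCombination ℂ fun i => pderiv i f

theorem dirDeriv_apply (f : MvPolynomial (Fin m) ℂ) (w : Fin m → ℂ) :
    dirDeriv f w = ∑ i, w i • pderiv i f :=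
  Fintype.linearCombination_apply _ _ _

theorem isHomogeneous_dirDeriv {e : ℕ} (hf : f.IsHomogeneous (e + 1)) (w : Fin m → ℂ) :
    (dirDeriv f w).IsHomogeneous e := by
  rw [dirDeriv_apply]
  exact (homogeneousSubmodule (Fin m) ℂ e).sum_mem fun i _ => Submodule.smul_mem _ _ hf.pderiv

theorem pderiv_restrict {ℓ : Module.Dual ℂ (Fin m → ℂ)}
    (b : Module.Basis (Fin n) ℂ (LinearMap.ker ℓ)) (f : MvPolynomial (Fin m) ℂ) (j : Fin n) :
    pderiv j (restrict b f) = restrict b (dirDeriv f (b j)) := by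
  simp only [dirDeriv_apply]
  induction f using MvPolynomial.induction_on with
  | C a => simp [restrict]
  | add p q hp hq => simp [hp, hq, Finset.sum_add_distrib]
  | mul_X p i hp =>
    have hX : pderiv j (restrict b (X i)) = C ((b j : Fin m → ℂ) i) := by
      simp [restrict, pderiv_X, Pi.single_apply]
    have hmul : ∑ k, (b j : Fin m → ℂ) k • pderiv k (p * X i) =
        (∑ k, (b j : Fin m → ℂ) k • pderiv k p) * X i + p * C ((b j : Fin m → ℂ) i) := by
      simp [Derivation.leibniz, pderiv_X, Pi.single_apply, Finset.sum_add_distrib, smul_eq_C_mul,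
        Finset.mul_sum, mul_comm, mul_left_comm, add_comm]
    rw [hmul, map_mul, Derivation.leibniz, hX, hp, map_add, map_mul, map_mul]
    simp only [smul_eq_mul, restrict, algHom_C, algebraMap_eq]
    ring

theorem jacobianIdeal_eq_span_dirDeriv (B : Module.Basis (Fin n) ℂ (Fin m → ℂ)) :
    jacobianIdeal f = Ideal.span (Set.range fun j => dirDeriv f (B j)) := by
  apply le_antisymm
  · have hmem : ∀ w, dirDeriv f w ∈ Ideal.span (Set.range fun j => dirDeriv f (B j)) := by
      intro w
      rw [← B.sum_repr w, map_sum]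
      exact Ideal.sum_mem _ fun j _ => by
        rw [map_smul]
        exact Submodule.smul_of_tower_mem _ _ (Ideal.subset_span ⟨j, rfl⟩)
    refine Ideal.span_le.2 ?_
    rintro _ ⟨i, rfl⟩
    have hi := hmem (Pi.single i 1)
    simpa [dirDeriv_apply, Pi.single_apply, ite_smul] using hi
  · refine Ideal.span_le.2 ?_
    rintro _ ⟨j, rfl⟩
    change dirDeriv f (B j) ∈ _
    rw [dirDeriv_apply]
    exact Ideal.sum_mem _ fun i _ => Submodule.smul_of_tower_mem _ _ (Ideal.subset_span ⟨i, rfl⟩)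

end DirectionalDerivative

section Singularities

variable {m n d : ℕ} {ℓ : Module.Dual ℂ (Fin m → ℂ)} {f : MvPolynomial (Fin m) ℂ}

theorem eq_zero_of_hyperplane_inter_singularLocus (hf : f.IsHomogeneous (d + 1))
    (hH : hyperplane ℓ ∩ singularLocus f = ∅) {w : Fin m → ℂ} (hw : ℓ w = 0)
    (h : ∀ i, eval w (pderiv i f) = 0) : w = 0 := by
  by_contra hw0
  obtain ⟨a, ha⟩ := Projectivization.exists_smul_eq_mk_rep ℂ w hw0
  have hrep : (Projectivization.mk ℂ w hw0).rep = (a : ℂ) • w := ha.symm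
  have heuler : (d + 1) • eval w f = 0 := by
    rw [← map_nsmul, ← hf.sum_X_mul_pderiv, map_sum]
    exact Finset.sum_eq_zero fun i _ => by rw [map_mul, h, mul_zero]
  have hfw : eval w f = 0 := (smul_eq_zero.1 heuler).resolve_left d.succ_ne_zero
  refine (Set.ext_iff.1 hH (Projectivization.mk ℂ w hw0)).1 ⟨?_, ?_, fun i => ?_⟩
  · change ℓ (Projectivization.mk ℂ w hw0).rep = 0
    rw [hrep, map_smul, hw, smul_zero]
  · rw [hrep, eval_smul_of_isHomogeneous hf, hfw, mul_zero]
  · rw [hrep, eval_smul_of_isHomogeneous hf.pderiv, h, mul_zero]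

theorem eq_zero_of_eval_restrict_pderiv (hf : f.IsHomogeneous (d + 1))
    (hH : hyperplane ℓ ∩ singularLocus f = ∅) (b : Module.Basis (Fin n) ℂ (LinearMap.ker ℓ))
    {y : Fin n → ℂ} (h : ∀ i, eval y (restrict b (pderiv i f)) = 0) : y = 0 := by
  simp only [eval_restrict] at h
  have hcoe : ((∑ j, y j • b j : LinearMap.ker ℓ) : Fin m → ℂ) = ∑ j, y j • (b j : Fin m → ℂ) := by
    simp
  rw [← hcoe] at h
  have hzero := eq_zero_of_hyperplane_inter_singularLocus hf hH
    (LinearMap.mem_ker.1 (Subtype.prop _)) h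
  rw [Submodule.coe_eq_zero] at hzero
  exact _root_.funext (Fintype.linearIndependent_iff.1 b.linearIndependent y hzero)

end Singularities

section Saturation

variable {m N : ℕ} {J : Ideal (MvPolynomial (Fin m) ℂ)} {h x : MvPolynomial (Fin m) ℂ}

theorem mem_saturation_of_pow_mul_mem {M : ℕ}
    (hJ : irrelevantIdeal m ^ N ≤ J ⊔ Ideal.span {h}) (hx : h ^ M * x ∈ J) :
    x ∈ saturation J := by
  refine (mem_saturation_iff J x).2 ⟨N * (1 + M), fun p hp => ?_⟩
  rw [pow_mul] at hp
  have hsup := Ideal.sup_pow_add_le_pow_sup_pow (Ideal.pow_right_mono hJ _ hp)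
  rw [pow_one, Ideal.span_singleton_pow] at hsup
  obtain ⟨c, hc⟩ := mem_sup_span_singleton_iff.1 hsup
  convert J.add_mem (J.mul_mem_left x hc) (J.mul_mem_left c hx) using 1
  ring

theorem exists_pow_mul_mem_of_mem_saturation (hh : h ∈ irrelevantIdeal m)
    (hx : x ∈ saturation J) : ∃ M, h ^ M * x ∈ J := by
  obtain ⟨M, hM⟩ := (mem_saturation_iff J x).1 hx
  refine ⟨M, ?_⟩
  rw [mul_comm]
  exact hM _ (Ideal.pow_mem_pow hh M)

theorem s_le {g p : MvPolynomial (Fin m) ℂ} {i : ℕ} (hp : p ∈ saturatedJacobianIdeal g)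
    (hpi : p.IsHomogeneous i) (hp0 : p ≠ 0) : s g ≤ i :=
  Nat.sInf_le ⟨p, hp, hpi, hp0⟩

theorem r_le {g : MvPolynomial (Fin m) ℂ} {a : Fin m → MvPolynomial (Fin m) ℂ} {i : ℕ}
    (ha : a ∈ syz g) (hai : ∀ j, (a j).IsHomogeneous i) (ha0 : a ≠ 0) : r g ≤ i :=
  Nat.sInf_le ⟨a, ha, hai, ha0⟩

end Saturation

section HyperplaneSection

variable {m n e i k : ℕ} {f : MvPolynomial (Fin m) ℂ} {ℓ : Module.Dual ℂ (Fin m → ℂ)}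
  {b : Module.Basis (Fin n) ℂ (LinearMap.ker ℓ)} {B : Module.Basis (Fin (n + 1)) ℂ (Fin m → ℂ)}

theorem map_restrict_jacobianIdeal (hB : ∀ j, B j.succ = b j) :
    (jacobianIdeal f).map (restrict b) =
      jacobianIdeal (restrict b f) ⊔ Ideal.span {restrict b (dirDeriv f (B 0))} := by
  rw [jacobianIdeal_eq_span_dirDeriv B, map_span_range, Fin.range_fin_succ, Ideal.span_insert,
    sup_comm]
  simp only [jacobianIdeal, pderiv_restrict, Fin.tail_def, hB]

theorem exists_pow_le_map_restrict_jacobianIdeal (hf : f.IsHomogeneous (e + 1))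
    (hH : hyperplane ℓ ∩ singularLocus f = ∅) (b : Module.Basis (Fin n) ℂ (LinearMap.ker ℓ)) :
    ∃ N, irrelevantIdeal n ^ N ≤ (jacobianIdeal f).map (restrict b) := by
  rw [jacobianIdeal, map_span_range]
  exact exists_pow_idealOfVars_le fun y hy => eq_zero_of_eval_restrict_pderiv hf hH b hy

theorem eq_zero_of_sum_mul_restrict_dirDeriv_eq_zero (hf : f.IsHomogeneous (e + 1))
    (hH : hyperplane ℓ ∩ singularLocus f = ∅) (hB : ∀ j, B j.succ = b j)
    {a : Fin (n + 1) → MvPolynomial (Fin n) ℂ} (ha : ∀ j, (a j).IsHomogeneous i)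
    (hr : i < r (restrict b f)) (hs : i < s (restrict b f))
    (h : ∑ j, a j * restrict b (dirDeriv f (B j)) = 0) (j : Fin (n + 1)) : a j = 0 := by
  simp only [Fin.sum_univ_succ, hB, ← pderiv_restrict] at h
  have ha₀ : a 0 = 0 := by
    by_contra hne
    obtain ⟨N, hN⟩ := exists_pow_le_map_restrict_jacobianIdeal hf hH b
    rw [map_restrict_jacobianIdeal hB] at hN
    refine hs.not_ge (s_le (mem_saturation_of_pow_mul_mem (M := 1) hN ?_) (ha 0) hne)
    rw [pow_one, mul_comm, eq_neg_of_add_eq_zero_left h]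
    exact neg_mem (Ideal.sum_mem _ fun j _ => Ideal.mul_mem_left _ _ (Ideal.subset_span ⟨j, rfl⟩))
  have ha_succ : (fun j : Fin n => a j.succ) = 0 := by
    by_contra hne
    rw [ha₀, zero_mul, zero_add] at h
    exact hr.not_ge (r_le ((mem_syz_iff _ _).2 h) (fun j => ha j.succ) hne)
  exact Fin.cases ha₀ (congrFun ha_succ) j

theorem mem_jacobianIdeal_of_linearForm_mul_mem (hf : f.IsHomogeneous (e + 2)) (hℓ : ℓ ≠ 0)
    (hH : hyperplane ℓ ∩ singularLocus f = ∅) (hr : k < e + r (restrict b f))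
    (hs : k < e + s (restrict b f)) {p : MvPolynomial (Fin m) ℂ} (hp : p.IsHomogeneous k)
    (h : linearForm ℓ * p ∈ jacobianIdeal f) : p ∈ jacobianIdeal f := by
  obtain ⟨B, -, hB⟩ := exists_basis_extending b hℓ
  have hDh : ∀ j, (dirDeriv f (B j)).IsHomogeneous (e + 1) := fun j => isHomogeneous_dirDeriv hf _
  have hlp : (linearForm ℓ * p).IsHomogeneous (k + 1) := by
    simpa only [add_comm] using (linearForm_isHomogeneous ℓ).mul hp
  rw [jacobianIdeal_eq_span_dirDeriv B] at h ⊢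
  rcases lt_or_ge k e with hke | hke
  · have hlp0 := eq_zero_of_mem_span_of_lt hDh hlp h (by omega)
    rw [(mul_eq_zero.1 hlp0).resolve_left (linearForm_ne_zero hℓ)]
    exact zero_mem _
  obtain ⟨i, rfl⟩ := Nat.exists_eq_add_of_le' hke
  obtain ⟨a, ha, hap⟩ := exists_isHomogeneous_sum_eq_of_mem_span hDh hlp h
  have hres : ∑ j, restrict b (a j) * restrict b (dirDeriv f (B j)) = 0 := by
    simp only [← map_mul, ← map_sum, hap]
    rw [map_mul, restrict_linearForm_self, zero_mul]
  have hdvd : ∀ j, ∃ c, c * linearForm ℓ = a j := by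
    intro j
    rw [← Ideal.mem_span_singleton', ← ker_restrict (b := b) hℓ]
    exact eq_zero_of_sum_mul_restrict_dirDeriv_eq_zero hf hH hB
      (fun j => isHomogeneous_restrict b (ha j)) (by omega) (by omega) hres j
  choose c hc using hdvd
  refine Ideal.mem_span_range_iff_exists_fun.2 ⟨c, mul_left_cancel₀ (linearForm_ne_zero hℓ) ?_⟩
  rw [← hap, Finset.mul_sum]
  exact Finset.sum_congr rfl fun j _ => by rw [← hc]; ring

theorem pow_irrelevantIdeal_le_sup_of_map_restrict (hℓ : ℓ ≠ 0) {N : ℕ}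
    {Q : Ideal (MvPolynomial (Fin m) ℂ)} (h : irrelevantIdeal n ^ N ≤ Q.map (restrict b)) :
    irrelevantIdeal m ^ N ≤ Q ⊔ Ideal.span {linearForm ℓ} := by
  have hX : (irrelevantIdeal m).map (restrict b) ≤ irrelevantIdeal n := by
    rw [irrelevantIdeal, map_span_range, Ideal.span_le]
    rintro _ ⟨i, rfl⟩
    exact mem_idealOfVars_of_isHomogeneous (isHomogeneous_restrict b (isHomogeneous_X ℂ i))
  rw [← comap_map_restrict hℓ, ← Ideal.map_le_iff_le_comap, Ideal.map_pow]
  exact (Ideal.pow_right_mono hX N).trans h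

end HyperplaneSection

section JacobianGenerators

variable {n e i k : ℕ} {f : MvPolynomial (Fin (n + 1)) ℂ} {ℓ : Module.Dual ℂ (Fin (n + 1) → ℂ)}
  {b : Module.Basis (Fin n) ℂ (LinearMap.ker ℓ)}

theorem exists_jacobianIdeal_eq_sup (hf : f.IsHomogeneous (e + 2))
    (hH : hyperplane ℓ ∩ singularLocus f = ∅) (b : Module.Basis (Fin n) ℂ (LinearMap.ker ℓ)) :
    ∃ (p : MvPolynomial (Fin (n + 1)) ℂ) (q : Fin n → MvPolynomial (Fin (n + 1)) ℂ),
      p.IsHomogeneous (e + 1) ∧ (∀ j, (q j).IsHomogeneous (e + 1)) ∧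
      jacobianIdeal f = Ideal.span (Set.range q) ⊔ Ideal.span {p} ∧
      IsParameterSystem (fun _ => e) fun j => restrict b (q j) := by
  have hfi : ∀ i, (pderiv i f).IsHomogeneous (e + 1) := fun i => hf.pderiv
  obtain ⟨i₀, c, hc⟩ := exists_isParameterSystem_sub
    (fun i => isHomogeneous_restrict b (hfi i))
    fun y hy => eq_zero_of_eval_restrict_pderiv hf hH b hy
  refine ⟨pderiv i₀ f, fun j => pderiv (i₀.succAbove j) f - C (c j) * pderiv i₀ f, hfi i₀,
    fun j => (hfi _).sub ((hfi i₀).C_mul _), ?_, ?_⟩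
  · exact (span_range_sub_sup (fun i => pderiv i f) i₀ fun j => C (c j)).symm
  · simpa [restrict] using hc

theorem IsParameterSystem.cons_linearForm {d : Fin n → ℕ}
    {q : Fin n → MvPolynomial (Fin (n + 1)) ℂ} (hℓ : ℓ ≠ 0)
    (hqh : ∀ j, (q j).IsHomogeneous (d j + 1))
    (hq : IsParameterSystem d fun j => restrict b (q j)) :
    IsParameterSystem (Fin.cons 0 d : Fin (n + 1) → ℕ)
      (Fin.cons (linearForm ℓ) q : Fin (n + 1) → MvPolynomial (Fin (n + 1)) ℂ) where
  isHomogeneous := Fin.cases (linearForm_isHomogeneous ℓ) hqh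
  exists_pow_le := by
    obtain ⟨N, hN⟩ := hq.exists_pow_le
    rw [← map_span_range] at hN
    refine ⟨N, (pow_irrelevantIdeal_le_sup_of_map_restrict hℓ hN).trans_eq ?_⟩
    rw [Fin.range_cons, Ideal.span_insert, sup_comm]

theorem isSMulRegular_linearForm {d : Fin n → ℕ} {q : Fin n → MvPolynomial (Fin (n + 1)) ℂ}
    (hℓ : ℓ ≠ 0) (hqh : ∀ j, (q j).IsHomogeneous (d j + 1))
    (hq : IsParameterSystem d fun j => restrict b (q j)) :
    IsSMulRegular (MvPolynomial (Fin (n + 1)) ℂ ⧸ Ideal.span (Set.range q)) (linearForm ℓ) := by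
  have h :=
    (hq.cons_linearForm hℓ hqh).isGorensteinFamily.regular (Set.range Fin.succ) 0 (by simp)
  rwa [← Set.range_comp, Fin.cons_zero,
    show (Fin.cons (linearForm ℓ) q : Fin (n + 1) → _) ∘ Fin.succ = q from rfl] at h

-- Linkage: `p * u ∈ Q + (ℓ)` lifts to `p * u - w * ℓ ∈ Q`, where `w` is killed by `ℓ` in the
-- Milnor algebra, hence is zero there by injectivity in low degrees.
theorem mul_mem_sup_linearForm {Q : Ideal (MvPolynomial (Fin (n + 1)) ℂ)} {M : ℕ}
    {p u c : MvPolynomial (Fin (n + 1)) ℂ} (hf : f.IsHomogeneous (e + 2)) (hℓ : ℓ ≠ 0)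
    (hH : hyperplane ℓ ∩ singularLocus f = ∅) (hr : i < r (restrict b f))
    (hs : i < s (restrict b f)) (hQ : Q.IsHomogeneous (homogeneousSubmodule _ ℂ))
    (hreg : IsSMulRegular (MvPolynomial (Fin (n + 1)) ℂ ⧸ Q) (linearForm ℓ))
    (hJ : jacobianIdeal f = Q ⊔ Ideal.span {p}) (hp : p.IsHomogeneous (e + 1))
    (hu : u.IsHomogeneous i) (hpu : p * u ∈ Q ⊔ Ideal.span {linearForm ℓ})
    (hc : linearForm ℓ ^ M * c ∈ jacobianIdeal f) :
    c * u ∈ Q ⊔ Ideal.span {linearForm ℓ} := by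
  have hpu_deg : (p * u).IsHomogeneous (e + i + 1) := by
    convert hp.mul hu using 1
    omega
  obtain ⟨w, hw, hwQ⟩ :=
    exists_isHomogeneous_sub_mul_mem hQ hpu_deg (linearForm_isHomogeneous ℓ) hpu
  have hlw : linearForm ℓ * w ∈ jacobianIdeal f := by
    rw [hJ]
    refine mem_sup_span_singleton_iff.2 ⟨u, ?_⟩
    convert Q.neg_mem hwQ using 1
    ring
  have hwJ := mem_jacobianIdeal_of_linearForm_mul_mem (b := b) hf hℓ hH (by omega) (by omega) hw hlw
  rw [hJ] at hwJ hc
  exact mul_mem_sup_of_link hreg hwQ hwJ hc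

theorem mem_jacobianIdeal_sup_linearForm (hf : f.IsHomogeneous (e + 2)) (hℓ : ℓ ≠ 0)
    (hH : hyperplane ℓ ∩ singularLocus f = ∅) (hr : n * e ≤ k + r (restrict b f))
    (hs : n * e ≤ k + s (restrict b f)) {c : MvPolynomial (Fin (n + 1)) ℂ}
    (hc : c.IsHomogeneous (k + 1)) (hcI : c ∈ saturatedJacobianIdeal f) :
    c ∈ jacobianIdeal f ⊔ Ideal.span {linearForm ℓ} := by
  obtain ⟨p, q, hp, hqh, hJ, hq⟩ := exists_jacobianIdeal_eq_sup hf hH b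
  obtain ⟨M, hM⟩ := exists_pow_mul_mem_of_mem_saturation
    (mem_idealOfVars_of_isHomogeneous (linearForm_isHomogeneous ℓ)) hcI
  obtain ⟨σ, hσ, hsoc⟩ := hq.isGorensteinFamily.exists_socle
  rw [← comap_map_restrict (b := b) hℓ, Ideal.mem_comap, hJ, Ideal.map_sup, map_span_range,
    Ideal.map_span, Set.image_singleton]
  refine hsoc.mem_sup_of_forall_mul_mem (isHomogeneous_span_range hq.isHomogeneous) hσ
    (isHomogeneous_restrict b hp) (isHomogeneous_restrict b hc) fun i u hi hu hpu => ?_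
  rw [Finset.sum_const, Finset.card_univ, Fintype.card_fin, smul_eq_mul] at hi
  obtain ⟨U, hU, rfl⟩ := exists_isHomogeneous_restrict_eq (b := b) hℓ hu
  rw [← map_mul, ← map_span_range, ← Ideal.mem_comap, comap_map_restrict hℓ] at hpu ⊢
  exact mul_mem_sup_linearForm (b := b) hf hℓ hH (by omega) (by omega)
    (isHomogeneous_span_range hqh) (isSMulRegular_linearForm hℓ hqh hq) hJ hp hU hpu hM

theorem exists_sub_linearForm_mul_mem (hf : f.IsHomogeneous (e + 2)) (hℓ : ℓ ≠ 0)
    (hH : hyperplane ℓ ∩ singularLocus f = ∅) (hr : n * e ≤ k + r (restrict b f))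
    (hs : n * e ≤ k + s (restrict b f)) {c : MvPolynomial (Fin (n + 1)) ℂ}
    (hc : c.IsHomogeneous (k + 1)) (hcI : c ∈ saturatedJacobianIdeal f) :
    ∃ c' ∈ saturatedJacobianIdeal f, c'.IsHomogeneous k ∧
      c - linearForm ℓ * c' ∈ jacobianIdeal f := by
  obtain ⟨c', hc', hcc'⟩ := exists_isHomogeneous_sub_mul_mem
    (isHomogeneous_span_range fun i => hf.pderiv) hc (linearForm_isHomogeneous ℓ)
    (mem_jacobianIdeal_sup_linearForm hf hℓ hH hr hs hc hcI)
  obtain ⟨M, hM⟩ := exists_pow_mul_mem_of_mem_saturation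
    (mem_idealOfVars_of_isHomogeneous (linearForm_isHomogeneous ℓ)) hcI
  obtain ⟨N, hN⟩ := exists_pow_le_map_restrict_jacobianIdeal hf hH b
  refine ⟨c', mem_saturation_of_pow_mul_mem (M := M + 1)
    (pow_irrelevantIdeal_le_sup_of_map_restrict hℓ hN) ?_, hc', by rwa [mul_comm]⟩
  convert (jacobianIdeal f).sub_mem hM ((jacobianIdeal f).mul_mem_left (linearForm ℓ ^ M) hcc')
    using 1
  ring

end JacobianGenerators

section MulMap

variable {m k : ℕ} {f : MvPolynomial (Fin m) ℂ} {ℓ : Module.Dual ℂ (Fin m → ℂ)}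

theorem mulMap_injective (h : ∀ p : MvPolynomial (Fin m) ℂ, p.IsHomogeneous k →
    linearForm ℓ * p ∈ jacobianIdeal f → p ∈ jacobianIdeal f) :
    Function.Injective (mulMap f ℓ k) := by
  refine (injective_iff_map_eq_zero _).2 ?_
  rintro ⟨_, q, hq, rfl⟩ hzero
  have hmk : ((jacobianIdeal f).submoduleOf (saturatedJacobianIdeal f)).mkQ
      (linearForm ℓ • q) = 0 := congrArg Subtype.val hzero
  rw [Submodule.mkQ_apply, Submodule.Quotient.mk_eq_zero] at hmk
  exact Subtype.ext ((Submodule.Quotient.mk_eq_zero _).2 (h q hq hmk))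

theorem mulMap_surjective (h : ∀ c ∈ saturatedJacobianIdeal f, c.IsHomogeneous (k + 1) →
    ∃ c' ∈ saturatedJacobianIdeal f, c'.IsHomogeneous k ∧
      c - linearForm ℓ * c' ∈ jacobianIdeal f) :
    Function.Surjective (mulMap f ℓ k) := by
  rintro ⟨_, c, hc, rfl⟩
  obtain ⟨c', hc', hk, hcc'⟩ := h c c.2 hc
  refine ⟨⟨_, ⟨c', hc'⟩, hk, rfl⟩, Subtype.ext (Eq.symm ?_)⟩
  exact (Submodule.Quotient.eq
    ((jacobianIdeal f).submoduleOf (saturatedJacobianIdeal f))).2 hcc'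

end MulMap

end JacobianModule

theorem corollary1p12_general {n d : ℕ} (hd : 2 ≤ d)
    {f : MvPolynomial (Fin (n + 1)) ℂ} (hf : f.IsHomogeneous d)
    {ℓ : Module.Dual ℂ (Fin (n + 1) → ℂ)} (hℓ : ℓ ≠ 0)
    (hH : JacobianModule.hyperplane ℓ ∩ JacobianModule.singularLocus f = ∅)
    (b : Module.Basis (Fin n) ℂ (LinearMap.ker ℓ))
    {g : MvPolynomial (Fin n) ℂ} (hg : g = JacobianModule.hyperplaneSection f ℓ b)
    {k₀ : ℤ} (hk₀ : k₀ = min ((d : ℤ) - 3 + JacobianModule.r g)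
      ((d : ℤ) - 3 + JacobianModule.s g)) :
    (∀ k : ℕ, (k : ℤ) ≤ k₀ → Function.Injective (JacobianModule.mulMap f ℓ k)) ∧
    (∀ k : ℕ, ((n : ℤ) + 1) * ((d : ℤ) - 2) - k₀ ≤ k + 1 →
      Function.Surjective (JacobianModule.mulMap f ℓ k)) := by
  obtain ⟨e, rfl⟩ := Nat.exists_eq_add_of_le' hd
  obtain rfl : g = JacobianModule.restrict b f := hg
  have hdeg : ((n : ℤ) + 1) * (((e + 2 : ℕ) : ℤ) - 2) = (n * e : ℕ) + e := by
    push_cast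
    ring
  refine ⟨fun k hk => JacobianModule.mulMap_injective fun p hp =>
    JacobianModule.mem_jacobianIdeal_of_linearForm_mul_mem (b := b) hf hℓ hH
      (by omega) (by omega) hp, fun k hk => JacobianModule.mulMap_surjective fun c hcI hc =>
    JacobianModule.exists_sub_linearForm_mul_mem (b := b) hf hℓ hH ?_ ?_ hc hcI⟩
  all_goals
    rw [hdeg] at hk
    omega

theorem corollary1p12 (n d : ℕ) (hn : 3 ≤ n) (hd : 3 ≤ d)
    (f : MvPolynomial (Fin (n + 1)) ℂ) (hf0 : f ≠ 0) (hf : f.IsHomogeneous d)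
    (ℓ : Module.Dual ℂ (Fin (n + 1) → ℂ)) (hℓ : ℓ ≠ 0)
    (hH : JacobianModule.hyperplane ℓ ∩ JacobianModule.singularLocus f = ∅)
    (b : Module.Basis (Fin n) ℂ (LinearMap.ker ℓ))
    (g : MvPolynomial (Fin n) ℂ) (hg : g = JacobianModule.hyperplaneSection f ℓ b)
    (hsing : (JacobianModule.singularLocus g).Nonempty)
    (k₀ : ℤ) (hk₀ : k₀ = min ((d : ℤ) - 3 + JacobianModule.r g) ((d : ℤ) - 3 + JacobianModule.s g)) :
    (∀ k : ℕ, (k : ℤ) ≤ k₀ → Function.Injective (JacobianModule.mulMap f ℓ k)) ∧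
    (∀ k : ℕ, ((n : ℤ) + 1) * ((d : ℤ) - 2) - k₀ ≤ (k : ℤ) →
      Function.Surjective (JacobianModule.mulMap f ℓ k)) := by
  have h := corollary1p12_general (by omega) hf hℓ hH b hg hk₀
  exact ⟨h.1, fun k hk => h.2 k (by omega)⟩
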